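/- Let $\mathcal G=(\mathcal V,\mathcal E)$ be a finite directed graph on $N$ nodes (loops allowed, no multiple edges), with adjacency matrix $\mathbf A=(a_{i,j})$, where $a_{i,j}=1$ if there is an edge from node $j$ to node $i$ and $a_{i,j}=0$ otherwise. Let $d_i^{\mathrm{in}}=\sum_j a_{i,j}$ and $d_j^{\mathrm{out}}=\sum_i a_{i,j}$ be the in- and out-degrees, and $\mathbf D_{\mathrm{in}}$, $\mathbf D_{\mathrm{out}}$ the corresponding diagonal matrices. Assume that every node has positive in-degree; for nodes of out-degree zero, if there are any, use the convention $0^{-1/2}=0$. The symmetrically normalized adjacency (SNA) is $\mathbf L=\mathbf D_{\mathrm{in}}^{-1/2}\mathbf A\,\mathbf D_{\mathrm{out}}^{-1/2}$. The graph is called weakly balanced if there is a vector $\mathbf k\in\mathbb R^N$, $\mathbf k\neq 0$, such that $$\sum_{j=1}^N a_{i,j}\left(\frac{k_j}{\sqrt{d_j^{\mathrm{out}}}}-\frac{k_i}{\sqrt{d_i^{\mathrm{in}}}}\right)=0\qquad\text{for all } i\in\{1,\dots,N\}.$$ The period of a graph is the greatest common divisor of the lengths of its directed closed walks of positive length (equivalently,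 of its directed cycles). Then $1$ is a (complex) eigenvalue of $\mathbf L$ if and only if $\mathcal G$ is weakly balanced. If moreover $\mathcal G$ is strongly connected, then $-1$ is an eigenvalue of $\mathbf L$ if and only if $\mathcal G$ is weakly balanced and its period is even. -/

import Mathlib

namespace Digraph

variable {V : Type*}

open Classical in
/-- The adjacency matrix: `a i j = 1` if there is an edge directed from node `j` to node `i`,
and `0` otherwise. -/
noncomputable def adjMatrix (G : Digraph V) : Matrix V V ℝ :=
  Matrix.of fun i j => if G.Adj j i then 1 else 0

/-- The in-degrees, the entries of the vector `A 1`. -/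
noncomputable def inDegree [Fintype V] (G : Digraph V) : V → ℝ :=
  Matrix.mulVec G.adjMatrix 1

/-- The out-degrees, the entries of the vector `Aᵀ 1`. -/
noncomputable def outDegree [Fintype V] (G : Digraph V) : V → ℝ :=
  Matrix.mulVec G.adjMatrix.transpose 1

/-- The symmetrically normalized adjacency `D_in^(-1/2) A D_out^(-1/2)`
(with `0^(-1/2) = 0`). -/
noncomputable def sna [Fintype V] [DecidableEq V] (G : Digraph V) : Matrix V V ℝ :=
  Matrix.diagonal (fun i => (Real.sqrt (G.inDegree i))⁻¹) * G.adjMatrix *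
    Matrix.diagonal (fun j => (Real.sqrt (G.outDegree j))⁻¹)

/-- The complex number `μ` is an eigenvalue of the symmetrically normalized adjacency,
seen as a complex matrix. -/
def IsSnaEigenvalue [Fintype V] [DecidableEq V] (G : Digraph V) (μ : ℂ) : Prop :=
  Module.End.HasEigenvalue (Matrix.toLin' (G.sna.map (fun x : ℝ => (x : ℂ)))) μ

/-- Weak balance: some nonzero real vector `k` satisfies
`∑ j, a i j * (k j / √(d_out j) - k i / √(d_in i)) = 0` for every node `i`. -/
def WeaklyBalanced [Fintype V] (G : Digraph V) : Prop :=
  ∃ k : V → ℝ, k ≠ 0 ∧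
    ∀ i, ∑ j, G.adjMatrix i j *
      (k j / Real.sqrt (G.outDegree j) - k i / Real.sqrt (G.inDegree i)) = 0

/-- There is a directed walk with `n` edges from `u` to `v`. -/
def HasWalk (G : Digraph V) (n : ℕ) (u v : V) : Prop :=
  ∃ w : ℕ → V, w 0 = u ∧ w n = v ∧ ∀ i < n, G.Adj (w i) (w (i + 1))

/-- Every node can be reached from every node by a (possibly empty) directed walk. -/
def StronglyConnected (G : Digraph V) : Prop :=
  ∀ u v : V, ∃ n : ℕ, G.HasWalk n u v

/-- The period: the greatest common divisor of the lengths of all directed closed walks of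
positive length (equivalently, of all directed cycles). It is `0` if there are none. -/
noncomputable def period (G : Digraph V) : ℕ :=
  sSup {d : ℕ | ∀ n : ℕ, 0 < n → (∃ v : V, G.HasWalk n v v) → d ∣ n}

end Digraph

/-!
Put `x j = k j / √(d_out j)` and `y i = μ * k i / √(d_in i)`. When `‖μ‖ = 1`, the equation
`L k = μ k` says that `y i` is the mean of the `x j` over the edges `j ⟶ i`, while
`∑ d_out j * ‖x j‖ ^ 2 ≤ ‖k‖ ^ 2 = ∑ d_in i * ‖y i‖ ^ 2`. Averaging loses exactly the variance, so
every variance vanishes: `x j = y i` across each edge. Hence the moduli `‖k i‖` witness weak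
balance, and the phases of `k` are multiplied by `μ` at each step back along an edge. In a
strongly connected graph such phases exist exactly when `μ ^ n = 1` for the length `n` of every
closed walk, that is, when `μ ^ period = 1`; for `μ = -1` this means that the period is even.
-/

namespace WeakBalance

open Finset
open scoped Matrix

section Scaling

variable {E : Type*} [SeminormedAddCommGroup E] [NormedSpace ℝ E]

theorem mul_norm_inv_sqrt_smul_sq {d : ℝ} (hd : 0 < d) (x : E) :
    d * ‖(√d)⁻¹ • x‖ ^ 2 = ‖x‖ ^ 2 := by
  rw [norm_smul, mul_pow, norm_inv, inv_pow, Real.norm_eq_abs, sq_abs, Real.sq_sqrt hd.le,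
    mul_inv_cancel_left₀ hd.ne']

theorem mul_norm_inv_sqrt_smul_sq_le (d : ℝ) (x : E) :
    d * ‖(√d)⁻¹ • x‖ ^ 2 ≤ ‖x‖ ^ 2 := by
  rcases le_or_gt d 0 with hd | hd
  · exact (mul_nonpos_of_nonpos_of_nonneg hd (sq_nonneg _)).trans (sq_nonneg _)
  · exact (mul_norm_inv_sqrt_smul_sq hd x).le

end Scaling

section Barycenter

variable {ι κ E : Type*} [NormedAddCommGroup E] [InnerProductSpace ℝ E]

theorem sum_mul_norm_sub_sq (s : Finset κ) {w : κ → ℝ} {x : κ → E} {y : E}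
    (h : ∑ j ∈ s, w j • (x j - y) = 0) :
    ∑ j ∈ s, w j * ‖x j - y‖ ^ 2 = ∑ j ∈ s, w j * ‖x j‖ ^ 2 - (∑ j ∈ s, w j) * ‖y‖ ^ 2 := by
  have hcross : ∑ j ∈ s, w j * inner ℝ y (x j - y) = 0 := by
    simp_rw [← real_inner_smul_right, ← inner_sum, h, inner_zero_right]
  have hexpand (j : κ) :
      ‖x j‖ ^ 2 = ‖y‖ ^ 2 + 2 * inner ℝ y (x j - y) + ‖x j - y‖ ^ 2 := by
    rw [← norm_add_sq_real, add_sub_cancel]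
  calc ∑ j ∈ s, w j * ‖x j - y‖ ^ 2
      = ∑ j ∈ s, (w j * ‖x j‖ ^ 2 - w j * ‖y‖ ^ 2 - 2 * (w j * inner ℝ y (x j - y))) :=
        sum_congr rfl fun j _ => by rw [hexpand]; ring
    _ = ∑ j ∈ s, w j * ‖x j‖ ^ 2 - (∑ j ∈ s, w j) * ‖y‖ ^ 2 := by
        rw [sum_sub_distrib, sum_sub_distrib, ← mul_sum, hcross, ← sum_mul, mul_zero, sub_zero]

theorem eq_of_sum_smul_sub_eq_zero [Fintype ι] [Fintype κ] {w : ι → κ → ℝ}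
    (hw : ∀ i j, 0 ≤ w i j) {x : κ → E} {y : ι → E}
    (hmean : ∀ i, ∑ j, w i j • (x j - y i) = 0)
    (henergy : ∑ j, (∑ i, w i j) * ‖x j‖ ^ 2 ≤ ∑ i, (∑ j, w i j) * ‖y i‖ ^ 2)
    {i : ι} {j : κ} (hij : w i j ≠ 0) : x j = y i := by
  have hterm (i : ι) (j : κ) : 0 ≤ w i j * ‖x j - y i‖ ^ 2 :=
    mul_nonneg (hw i j) (sq_nonneg _)
  have hrow (i : ι) : 0 ≤ ∑ j, w i j * ‖x j - y i‖ ^ 2 := sum_nonneg fun j _ => hterm i j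
  have htotal : ∑ i, ∑ j, w i j * ‖x j - y i‖ ^ 2 = 0 := by
    refine le_antisymm ?_ (sum_nonneg fun i _ => hrow i)
    simp_rw [sum_mul_norm_sub_sq univ (hmean _), sum_sub_distrib]
    rw [sum_comm]
    simpa only [← sum_mul, sub_nonpos] using henergy
  have hzero : w i j * ‖x j - y i‖ ^ 2 = 0 := by
    have hi := (sum_eq_zero_iff_of_nonneg fun i _ => hrow i).mp htotal i (mem_univ i)
    exact (sum_eq_zero_iff_of_nonneg fun j _ => hterm i j).mp hi j (mem_univ j)
  simpa [hij, sub_eq_zero] using hzero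

end Barycenter

section Degree

variable {V : Type*} (G : Digraph V)

theorem adjMatrix_nonneg (i j : V) : 0 ≤ G.adjMatrix i j := by
  by_cases h : G.Adj j i <;> simp [Digraph.adjMatrix, h]

theorem adjMatrix_ne_zero_iff {i j : V} : G.adjMatrix i j ≠ 0 ↔ G.Adj j i := by
  simp [Digraph.adjMatrix]

variable [Fintype V]

theorem inDegree_eq_sum (i : V) : G.inDegree i = ∑ j, G.adjMatrix i j := by
  simp [Digraph.inDegree, Matrix.mulVec, dotProduct]

theorem outDegree_eq_sum (j : V) : G.outDegree j = ∑ i, G.adjMatrix i j := by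
  simp [Digraph.outDegree, Matrix.mulVec, dotProduct]

theorem outDegree_pos_of_adj {i j : V} (h : G.Adj j i) : 0 < G.outDegree j := by
  rw [outDegree_eq_sum]
  exact sum_pos' (fun i _ => adjMatrix_nonneg G i j)
    ⟨i, mem_univ i, (adjMatrix_nonneg G i j).lt_of_ne' ((adjMatrix_ne_zero_iff G).mpr h)⟩

end Degree

section EdgeBalance

variable {V : Type*} [Fintype V] {G : Digraph V} {𝕜 : Type*} [RCLike 𝕜] {μ : 𝕜} {k : V → 𝕜}

/-- The edgewise form of the eigenvalue equation `L k = μ k`: across every edge `j ⟶ i` the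
value `k j`, scaled by the out-degree of `j`, is `μ` times the value `k i`, scaled by the
in-degree of `i`. -/
def IsEdgeBalanced (G : Digraph V) (μ : 𝕜) (k : V → 𝕜) : Prop :=
  ∀ ⦃j i⦄, G.Adj j i → (√(G.outDegree j))⁻¹ • k j = μ * (√(G.inDegree i))⁻¹ • k i

theorem isEdgeBalanced_iff_sum_eq_zero (hin : ∀ i, 0 < G.inDegree i) (hμ : ‖μ‖ = 1) :
    IsEdgeBalanced G μ k ↔ ∀ i, ∑ j, G.adjMatrix i j •
      ((√(G.outDegree j))⁻¹ • k j - μ * (√(G.inDegree i))⁻¹ • k i) = 0 := by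
  constructor
  · intro h i
    refine sum_eq_zero fun j _ => ?_
    by_cases hij : G.Adj j i
    · rw [h hij, sub_self, smul_zero]
    · rw [not_ne_iff.mp (mt (adjMatrix_ne_zero_iff G).mp hij), zero_smul]
  · intro h j i hij
    refine eq_of_sum_smul_sub_eq_zero (adjMatrix_nonneg G) h ?_ ((adjMatrix_ne_zero_iff G).mpr hij)
      (x := fun j => (√(G.outDegree j))⁻¹ • k j) (y := fun i => μ * (√(G.inDegree i))⁻¹ • k i)
    simp_rw [← inDegree_eq_sum, ← outDegree_eq_sum, norm_mul, hμ, one_mul,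
      mul_norm_inv_sqrt_smul_sq (hin _)]
    exact sum_le_sum fun j _ => mul_norm_inv_sqrt_smul_sq_le _ _

theorem weaklyBalanced_iff_exists_isEdgeBalanced (hin : ∀ i, 0 < G.inDegree i) :
    G.WeaklyBalanced ↔ ∃ k : V → ℝ, k ≠ 0 ∧ IsEdgeBalanced G 1 k := by
  simp only [isEdgeBalanced_iff_sum_eq_zero hin norm_one, one_mul, smul_eq_mul, ← div_eq_inv_mul]
  rfl

theorem IsEdgeBalanced.norm (h : IsEdgeBalanced G μ k) (hμ : ‖μ‖ = 1) :
    IsEdgeBalanced G (1 : ℝ) fun i => ‖k i‖ := by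
  intro j i hij
  simpa [norm_smul, hμ, abs_of_nonneg, Real.sqrt_nonneg] using congrArg (‖·‖) (h hij)

theorem IsEdgeBalanced.weaklyBalanced (h : IsEdgeBalanced G μ k) (hμ : ‖μ‖ = 1) (hk : k ≠ 0)
    (hin : ∀ i, 0 < G.inDegree i) : G.WeaklyBalanced := by
  refine (weaklyBalanced_iff_exists_isEdgeBalanced hin).mpr ⟨_, fun h0 => hk ?_, h.norm hμ⟩
  exact funext fun i => norm_eq_zero.mp (congrFun h0 i)

theorem sna_map_mulVec_apply [DecidableEq V] (G : Digraph V) (k : V → ℂ) (i : V) :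
    (G.sna.map (fun x : ℝ => (x : ℂ)) *ᵥ k) i =
      (√(G.inDegree i))⁻¹ • ∑ j, G.adjMatrix i j • (√(G.outDegree j))⁻¹ • k j := by
  simp [Digraph.sna, Matrix.mulVec, dotProduct, smul_sum, mul_assoc]

theorem sna_map_mulVec_eq_smul_iff [DecidableEq V] (hin : ∀ i, 0 < G.inDegree i) (μ : ℂ)
    (k : V → ℂ) :
    G.sna.map (fun x : ℝ => (x : ℂ)) *ᵥ k = μ • k ↔ ∀ i, ∑ j, G.adjMatrix i j •
      ((√(G.outDegree j))⁻¹ • k j - μ * (√(G.inDegree i))⁻¹ • k i) = 0 := by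
  rw [funext_iff]
  refine forall_congr' fun i => ?_
  have hmean : (∑ j, G.adjMatrix i j) • (μ * (√(G.inDegree i))⁻¹ • k i) =
      √(G.inDegree i) • (μ * k i) := by
    rw [← inDegree_eq_sum, mul_smul_comm, smul_smul, ← div_eq_mul_inv, Real.div_sqrt]
  simp_rw [smul_sub, sum_sub_distrib, ← sum_smul, hmean, sub_eq_zero]
  rw [sna_map_mulVec_apply, inv_smul_eq_iff₀ (Real.sqrt_pos.mpr (hin i)).ne', Pi.smul_apply,
    smul_eq_mul]

theorem isSnaEigenvalue_iff_exists_isEdgeBalanced [DecidableEq V]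
    (hin : ∀ i, 0 < G.inDegree i) {μ : ℂ} (hμ : ‖μ‖ = 1) :
    G.IsSnaEigenvalue μ ↔ ∃ k : V → ℂ, k ≠ 0 ∧ IsEdgeBalanced G μ k := by
  simp_rw [isEdgeBalanced_iff_sum_eq_zero hin hμ, ← sna_map_mulVec_eq_smul_iff hin]
  constructor
  · intro h
    obtain ⟨k, hk⟩ := h.exists_hasEigenvector
    exact ⟨k, hk.2, hk.apply_eq_smul⟩
  · rintro ⟨k, hk, h⟩
    exact Module.End.hasEigenvalue_of_hasEigenvector ⟨Module.End.mem_eigenspace_iff.mpr h, hk⟩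

end EdgeBalance

section Walk

variable {V : Type*} {G : Digraph V} {u v w : V} {m n : ℕ}

theorem hasWalk_zero_iff : G.HasWalk 0 u v ↔ u = v :=
  ⟨fun ⟨_, hu, hv, _⟩ => hu.symm.trans hv, fun h => ⟨fun _ => u, rfl, h, by simp⟩⟩

theorem hasWalk_succ_iff : G.HasWalk (n + 1) u w ↔ ∃ v, G.Adj u v ∧ G.HasWalk n v w := by
  constructor
  · rintro ⟨p, rfl, rfl, hp⟩
    exact ⟨p 1, hp 0 n.succ_pos, fun i => p (i + 1), rfl, rfl,
      fun i hi => hp (i + 1) (Nat.succ_lt_succ hi)⟩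
  · rintro ⟨v, huv, p, rfl, rfl, hp⟩
    refine ⟨fun i => Nat.casesOn i u p, rfl, rfl, fun i hi => ?_⟩
    cases i with
    | zero => exact huv
    | succ i => exact hp i (Nat.lt_of_succ_lt_succ hi)

theorem hasWalk_append (huv : G.HasWalk m u v) (hvw : G.HasWalk n v w) :
    G.HasWalk (m + n) u w := by
  induction m generalizing u with
  | zero => rwa [hasWalk_zero_iff.mp huv, zero_add]
  | succ m ih =>
    obtain ⟨u', hu, hu'⟩ := hasWalk_succ_iff.mp huv
    rw [Nat.add_right_comm]
    exact hasWalk_succ_iff.mpr ⟨u', hu, ih hu'⟩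

theorem dvd_period_iff {d : ℕ} : d ∣ G.period ↔ ∀ n v, G.HasWalk n v v → d ∣ n := by
  let S : Set ℕ := {d | ∀ n, 0 < n → (∃ v, G.HasWalk n v v) → d ∣ n}
  have mem_iff (d : ℕ) : d ∈ S ↔ ∀ n v, G.HasWalk n v v → d ∣ n := by
    refine ⟨fun h n v hv => ?_, fun h n _ ⟨v, hv⟩ => h n v hv⟩
    rcases n.eq_zero_or_pos with rfl | hn
    exacts [dvd_zero d, h n hn ⟨v, hv⟩]
  rw [← mem_iff]
  change d ∣ sSup S ↔ d ∈ S
  by_cases hclosed : ∃ n, 0 < n ∧ ∃ v, G.HasWalk n v v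
  · obtain ⟨N, hN, hwalk⟩ := hclosed
    have hbdd : BddAbove S := ⟨N, fun d hd => Nat.le_of_dvd hN (hd N hN hwalk)⟩
    have hmem : sSup S ∈ S := Nat.sSup_mem ⟨1, fun n _ _ => one_dvd n⟩ hbdd
    refine ⟨fun hd n hn hv => hd.trans (hmem n hn hv), fun hd => ?_⟩
    have hlcm : d.lcm (sSup S) ∈ S := fun n hn hv => Nat.lcm_dvd (hd n hn hv) (hmem n hn hv)
    have hlcm_pos : 0 < d.lcm (sSup S) := Nat.pos_of_dvd_of_pos (hlcm N hN hwalk) hN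
    have heq : d.lcm (sSup S) = sSup S :=
      (le_csSup hbdd hlcm).antisymm (Nat.le_of_dvd hlcm_pos (Nat.dvd_lcm_right _ _))
    exact heq ▸ Nat.dvd_lcm_left _ _
  · have huniv : S = Set.univ :=
      Set.eq_univ_of_forall fun d n hn hv => (hclosed ⟨n, hn, hv⟩).elim
    simp [huniv]

theorem pow_period_eq_one_iff {M : Type*} [Monoid M] {z : M} :
    z ^ G.period = 1 ↔ ∀ n v, G.HasWalk n v v → z ^ n = 1 := by
  simp_rw [← orderOf_dvd_iff_pow_eq_one, dvd_period_iff]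

end Walk

section Potential

/-- A multiplicative potential with ratio `z`: going back along an edge acts by `z`. The phases
of an eigenvector for an eigenvalue of modulus one form such a potential. -/
def IsPotential {V X M : Type*} [SMul M X] (G : Digraph V) (z : M) (c : V → X) : Prop :=
  ∀ ⦃u v⦄, G.Adj u v → c u = z • c v

variable {V X M : Type*} [Monoid M] [MulAction M X] {G : Digraph V} {z : M} {u v : V} {n : ℕ}

theorem IsPotential.eq_pow_smul_of_hasWalk {c : V → X} (hc : IsPotential G z c)
    (h : G.HasWalk n u v) : c u = z ^ n • c v := by
  induction n generalizing u with
  | zero => rw [hasWalk_zero_iff.mp h, pow_zero, one_smul]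
  | succ n ih =>
    obtain ⟨u', hu, hu'⟩ := hasWalk_succ_iff.mp h
    rw [hc hu, ih hu', smul_smul, pow_succ']

theorem IsPotential.ne_zero {𝕜 : Type*} [MonoidWithZero 𝕜] [NoZeroDivisors 𝕜]
    {z : 𝕜} {c : V → 𝕜} (hc : IsPotential G z c) (hG : G.StronglyConnected) (hz : z ≠ 0)
    (hne : c ≠ 0) (v : V) : c v ≠ 0 := by
  obtain ⟨w, hw⟩ := Function.ne_iff.mp hne
  obtain ⟨n, hvw⟩ := hG v w
  rw [hc.eq_pow_smul_of_hasWalk hvw]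
  exact mul_ne_zero (pow_ne_zero n hz) hw

theorem IsPotential.pow_period_eq_one {𝕜 : Type*} [MonoidWithZero 𝕜] [IsRightCancelMulZero 𝕜]
    {z : 𝕜} {c : V → 𝕜} (hc : IsPotential G z c) (hne : ∀ v, c v ≠ 0) :
    z ^ G.period = 1 :=
  pow_period_eq_one_iff.mpr fun _ v hv =>
    (mul_eq_right₀ (hne v)).mp (hc.eq_pow_smul_of_hasWalk hv).symm

theorem exists_isPotential_pow (hG : G.StronglyConnected) (hz : z ^ G.period = 1) :
    ∃ ℓ : V → ℕ, IsPotential G z fun v => z ^ ℓ v := by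
  rcases isEmpty_or_nonempty V with _ | ⟨⟨r⟩⟩
  · exact ⟨fun _ => 0, fun v => isEmptyElim v⟩
  choose ℓ hℓ using fun v => hG v r
  refine ⟨ℓ, fun u v huv => ?_⟩
  obtain ⟨m, hm⟩ := hG r u
  have hone := pow_period_eq_one_iff.mp hz
  have hu : z ^ (ℓ u + m) = 1 := hone _ u (hasWalk_append (hℓ u) hm)
  have hv : z ^ (ℓ v + 1 + m) = 1 :=
    hone _ u (hasWalk_append (hasWalk_succ_iff.mpr ⟨v, huv, hℓ v⟩) hm)
  calc z ^ ℓ u = z ^ (ℓ u + (ℓ v + 1 + m)) := by rw [pow_add, hv, mul_one]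
    _ = z ^ (ℓ v + 1 + (ℓ u + m)) := by congr 1; ring
    _ = z • z ^ ℓ v := by rw [pow_add, hu, mul_one, pow_succ', smul_eq_mul]

end Potential

section Spectrum

variable {V : Type*} [Fintype V] {G : Digraph V} {𝕜 : Type*} [RCLike 𝕜] {μ : 𝕜}

theorem IsEdgeBalanced.isPotential_normalize {k : V → 𝕜} (h : IsEdgeBalanced G μ k)
    (hμ : ‖μ‖ = 1) (hin : ∀ i, 0 < G.inDegree i) :
    IsPotential G μ fun i => NormedSpace.normalize (k i) := by
  intro j i hij
  have hout_pos : 0 < (√(G.outDegree j))⁻¹ :=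
    inv_pos.mpr (Real.sqrt_pos.mpr (outDegree_pos_of_adj G hij))
  have hin_pos : 0 < (√(G.inDegree i))⁻¹ := inv_pos.mpr (Real.sqrt_pos.mpr (hin i))
  calc NormedSpace.normalize (k j) = NormedSpace.normalize (μ * (√(G.inDegree i))⁻¹ • k i) := by
        rw [← NormedSpace.normalize_smul_of_pos hout_pos, h hij]
    _ = μ * NormedSpace.normalize ((√(G.inDegree i))⁻¹ • k i) := by
        rw [NormedSpace.normalize, norm_mul, hμ, one_mul, ← mul_smul_comm, NormedSpace.normalize]
    _ = μ • NormedSpace.normalize (k i) := by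
        rw [NormedSpace.normalize_smul_of_pos hin_pos, smul_eq_mul]

theorem IsEdgeBalanced.smul_isPotential {k : V → ℝ} (hk : IsEdgeBalanced G 1 k) {c : V → 𝕜}
    (hc : IsPotential G μ c) : IsEdgeBalanced G μ fun i => k i • c i := by
  intro j i hij
  have hkij := hk hij
  rw [one_mul, smul_eq_mul, smul_eq_mul] at hkij
  rw [smul_smul, hkij, hc hij, smul_eq_mul, smul_smul, mul_smul_comm]

theorem isSnaEigenvalue_of_weaklyBalanced [DecidableEq V] (hin : ∀ i, 0 < G.inDegree i)
    (hG : G.WeaklyBalanced) {μ : ℂ} (hμ : ‖μ‖ = 1) {c : V → ℂ} (hc : IsPotential G μ c)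
    (hne : ∀ i, c i ≠ 0) : G.IsSnaEigenvalue μ := by
  obtain ⟨k, hk, hbal⟩ := (weaklyBalanced_iff_exists_isEdgeBalanced hin).mp hG
  obtain ⟨v, hv⟩ := Function.ne_iff.mp hk
  exact (isSnaEigenvalue_iff_exists_isEdgeBalanced hin hμ).mpr
    ⟨_, Function.ne_iff.mpr ⟨v, smul_ne_zero hv (hne v)⟩, hbal.smul_isPotential hc⟩

theorem isSnaEigenvalue_one_iff [DecidableEq V] (hin : ∀ i, 0 < G.inDegree i) :
    G.IsSnaEigenvalue 1 ↔ G.WeaklyBalanced := by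
  refine ⟨fun h => ?_, fun h => ?_⟩
  · obtain ⟨k, hk, hbal⟩ := (isSnaEigenvalue_iff_exists_isEdgeBalanced hin norm_one).mp h
    exact hbal.weaklyBalanced norm_one hk hin
  · exact isSnaEigenvalue_of_weaklyBalanced hin h norm_one (c := 1)
      (fun _ _ _ => (one_smul ℂ _).symm) fun _ => one_ne_zero

theorem isSnaEigenvalue_iff_pow_period_eq_one [DecidableEq V] (hin : ∀ i, 0 < G.inDegree i)
    (hG : G.StronglyConnected) {μ : ℂ} (hμ : ‖μ‖ = 1) :
    G.IsSnaEigenvalue μ ↔ G.WeaklyBalanced ∧ μ ^ G.period = 1 := by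
  have hμ0 : μ ≠ 0 := norm_ne_zero_iff.mp (hμ ▸ one_ne_zero)
  constructor
  · intro h
    obtain ⟨k, hk, hbal⟩ := (isSnaEigenvalue_iff_exists_isEdgeBalanced hin hμ).mp h
    have hphase := hbal.isPotential_normalize hμ hin
    obtain ⟨v, hv⟩ := Function.ne_iff.mp hk
    have hne := hphase.ne_zero hG hμ0
      (Function.ne_iff.mpr ⟨v, (NormedSpace.normalize_eq_zero_iff _).not.mpr hv⟩)
    exact ⟨hbal.weaklyBalanced hμ hk hin, hphase.pow_period_eq_one hne⟩
  · rintro ⟨hbal, hperiod⟩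
    obtain ⟨ℓ, hℓ⟩ := exists_isPotential_pow hG hperiod
    exact isSnaEigenvalue_of_weaklyBalanced hin hbal hμ hℓ fun i => pow_ne_zero (ℓ i) hμ0

end Spectrum

end WeakBalance

theorem mainTheorem4_general {V : Type*} [Fintype V] [DecidableEq V] (G : Digraph V)
    (hin : ∀ i : V, 0 < G.inDegree i) :
    (G.IsSnaEigenvalue 1 ↔ G.WeaklyBalanced) ∧
      (G.StronglyConnected → ∀ μ : ℂ, ‖μ‖ = 1 →
        (G.IsSnaEigenvalue μ ↔ G.WeaklyBalanced ∧ μ ^ G.period = 1)) :=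
  ⟨WeakBalance.isSnaEigenvalue_one_iff hin,
    fun hG _ => WeakBalance.isSnaEigenvalue_iff_pow_period_eq_one hin hG⟩

theorem mainTheorem4 {V : Type*} [Fintype V] [DecidableEq V] (G : Digraph V)
    (hin : ∀ i : V, 0 < G.inDegree i) :
    (G.IsSnaEigenvalue 1 ↔ G.WeaklyBalanced) ∧
      (G.StronglyConnected →
        (G.IsSnaEigenvalue (-1) ↔ G.WeaklyBalanced ∧ Even G.period)) := by
  refine (mainTheorem4_general G hin).imp_right fun h hG => ?_
  rw [h hG (-1) (by simp), neg_one_pow_eq_one_iff_even (by norm_num)]
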